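/- Let $K\ge 1$ and let $p_1,\dots,p_K,q_1,\dots,q_K\ge 0$ satisfy $\sum_{k=1}^K p_k=\sum_{k=1}^K q_k=1$. The function $$C(u,v)=\prod_{k=1}^K\min(u^{p_k},v^{q_k}),\qquad (u,v)\in[0,1]^2,$$ is a copula (the comonotonic-based Liebscher copula). For a copula $C$, put $\beta(C)=4C(\tfrac12,\tfrac12)-1$ (Blomqvist's medial correlation coefficient), $\tau(C)=4\int_{[0,1]^2}C\,dC-1$ (Kendall's tau) and $\rho(C)=12\int_{[0,1]^2}C(u,v)\,du\,dv-3$ (Spearman's rho). Then $$\beta(C)=2^{\sum_{k=1}^K\min(p_k,q_k)}-1.$$ Suppose moreover that $(p_k,q_k)\ne(0,0)$ for all $k$, and that the pairs are numbered so that the ratios $r_k=p_k/q_k\in[0,\infty]$ are nondecreasing in $k$. With $\bar x_k=x_1+\dots+x_k$, $$\tau(C)=1-\sum_{k=1}^{K-1}\frac{(1-\bar p_k)\,\bar q_k\,(r_{k+1}-r_k)}{(\bar q_kr_k+(1-\bar p_k))(\bar q_kr_{k+1}+(1-\bar p_k))},$$ $$\rho(C)=\frac{12(1+r_1+r_1r_K)}{(2+r_1)(1+2r_K)}-3+12\sum_{k=1}^{K-1}\frac{r_{k+1}-r_k}{((1+\bar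 q_k)r_k+(2-\bar p_k))((1+\bar q_k)r_{k+1}+(2-\bar p_k))}.$$ When some ratios are infinite, each fraction is read after multiplying its numerator and denominator by $q_kq_{k+1}$ (by $q_1q_K$ for the first fraction in $\rho(C)$), so that $q_kr_k$ is replaced by $p_k$; for example $r_{k+1}-r_k$ becomes $p_{k+1}q_k-p_kq_{k+1}$. -/

import Mathlib

open scoped ENNReal

noncomputable section

/-- The closed unit square `[0,1]²`. -/
def unitSquare : Set (ℝ × ℝ) := Set.Icc 0 1 ×ˢ Set.Icc 0 1

/-- `μ` is the measure `dC` on `[0,1]²` of the bivariate distribution function `C`: a probability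
measure carried by `[0,1]²` with `μ ((-∞,u] × (-∞,v]) = C(u,v)` for `(u,v) ∈ [0,1]²`. -/
structure IsMeasureOf (C : ℝ → ℝ → ℝ) (μ : MeasureTheory.Measure (ℝ × ℝ)) : Prop where
  isProbabilityMeasure : MeasureTheory.IsProbabilityMeasure μ
  carried : μ unitSquareᶜ = 0
  cdf_eq : ∀ u ∈ Set.Icc (0 : ℝ) 1, ∀ v ∈ Set.Icc (0 : ℝ) 1,
    μ (Set.Iic u ×ˢ Set.Iic v) = ENNReal.ofReal (C u v)

/-- `C` is a bivariate copula: a distribution function on `[0,1]²` with uniform margins. -/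
def IsCopula (C : ℝ → ℝ → ℝ) : Prop :=
  (∃ μ, IsMeasureOf C μ) ∧ (∀ u ∈ Set.Icc (0 : ℝ) 1, C u 1 = u) ∧
    (∀ v ∈ Set.Icc (0 : ℝ) 1, C 1 v = v)

/-- A bivariate distribution function on `[0,1]²` determines its measure. -/
theorem IsMeasureOf.unique {C : ℝ → ℝ → ℝ} {μ ν : MeasureTheory.Measure (ℝ × ℝ)}
    (hμ : IsMeasureOf C μ) (hν : IsMeasureOf C ν) : μ = ν := by
  have := hμ.isProbabilityMeasure
  have := hν.isProbabilityMeasure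
  have key : ∀ (ρ : MeasureTheory.Measure (ℝ × ℝ)), IsMeasureOf C ρ → ∀ u v : ℝ,
      ρ (Set.Iic u ×ˢ Set.Iic v) =
        if 0 ≤ u ∧ 0 ≤ v then ENNReal.ofReal (C (min u 1) (min v 1)) else 0 := by
    intro ρ hρ u v
    split_ifs with h
    · rw [← hρ.cdf_eq (min u 1) ⟨le_min h.1 zero_le_one, min_le_right _ _⟩ (min v 1)
        ⟨le_min h.2 zero_le_one, min_le_right _ _⟩]
      apply MeasureTheory.measure_congr
      have h0 : ∀ᵐ z ∂ρ, z ∈ unitSquare := by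
        rw [MeasureTheory.ae_iff]; exact hρ.carried
      filter_upwards [h0] with z hz
      simp only [unitSquare, Set.mem_prod, Set.mem_Icc] at hz
      apply propext
      change (z ∈ Set.Iic u ×ˢ Set.Iic v) ↔ (z ∈ Set.Iic (min u 1) ×ˢ Set.Iic (min v 1))
      simp only [Set.mem_prod, Set.mem_Iic, le_min_iff]
      tauto
    · refine MeasureTheory.measure_mono_null ?_ hρ.carried
      intro z hz hz'
      simp only [unitSquare, Set.mem_prod, Set.mem_Icc, Set.mem_Iic] at hz hz'
      exact h ⟨by linarith, by linarith⟩
  have hspan : ∀ n : ℕ, (Set.Iic (n : ℝ)) ∈ Set.range (Set.Iic : ℝ → Set ℝ) := fun n => ⟨_, rfl⟩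
  have hcs : IsCountablySpanning (Set.range (Set.Iic : ℝ → Set ℝ)) := by
    refine ⟨fun n => Set.Iic (n : ℝ), hspan, ?_⟩
    ext x
    simpa using exists_nat_ge x
  have hgen : (inferInstance : MeasurableSpace (ℝ × ℝ)) = MeasurableSpace.generateFrom
      (Set.image2 (· ×ˢ ·) (Set.range (Set.Iic : ℝ → Set ℝ)) (Set.range Set.Iic)) := by
    refine (generateFrom_eq_prod ?_ ?_ hcs hcs).symm
    · rw [← borel_eq_generateFrom_Iic]; exact (BorelSpace.measurable_eq).symm
    · rw [← borel_eq_generateFrom_Iic]; exact (BorelSpace.measurable_eq).symm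
  refine MeasureTheory.ext_of_generate_finite _ hgen (isPiSystem_Iic.prod isPiSystem_Iic) ?_ ?_
  · rintro _ ⟨_, ⟨u, rfl⟩, _, ⟨v, rfl⟩, rfl⟩
    rw [key μ hμ, key ν hν]
  · simp

open Classical in
/-- The measure `dC` on `[0,1]²`; it is unique whenever it exists, as it does for copulas. -/
def measureOf (C : ℝ → ℝ → ℝ) : MeasureTheory.Measure (ℝ × ℝ) :=
  if h : ∃ μ, IsMeasureOf C μ then h.choose else 0

/-- Blomqvist's medial correlation coefficient `β(C) = 4 C(1/2, 1/2) - 1`. -/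
def blomqvistBeta (C : ℝ → ℝ → ℝ) : ℝ := 4 * C (1 / 2) (1 / 2) - 1

/-- Kendall's `τ(C) = 4 ∫_{[0,1]²} C(u,v) dC(u,v) - 1`. -/
def kendallTau (C : ℝ → ℝ → ℝ) : ℝ :=
  4 * (∫ z in unitSquare, C z.1 z.2 ∂(measureOf C)) - 1

/-- Spearman's `ρ(C) = 12 ∫_{[0,1]²} C(u,v) du dv - 3`. -/
def spearmanRho (C : ℝ → ℝ → ℝ) : ℝ :=
  12 * (∫ z in unitSquare, C z.1 z.2) - 3

/-- The comonotonic-based Liebscher copula `C(u,v) = ∏_{k=1}^K min(u^{p_k}, v^{q_k})`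
for `(u,v) ∈ [0,1]²`. -/
def liebscherCL (K : ℕ) (p q : ℕ → ℝ) (u v : ℝ) : ℝ :=
  ∏ k ∈ Finset.Icc 1 K, min (u ^ p k) (v ^ q k)

/-- The partial sum `x_1 + ⋯ + x_k`. -/
def partialSum (x : ℕ → ℝ) (k : ℕ) : ℝ := ∑ j ∈ Finset.Icc 1 k, x j

/-- The ratio `r_k = p_k / q_k ∈ [0,∞]`, equal to `∞` when `q_k = 0 < p_k`. -/
def ratio (p q : ℕ → ℝ) (k : ℕ) : ℝ≥0∞ := ENNReal.ofReal (p k) / ENNReal.ofReal (q k)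

end

/-!
`C` is a product of the functions `min (u ^ p k) (v ^ q k)`. Each is the distribution function of a
comonotonic pair, and a product of distribution functions is the distribution function of the
coordinatewise maximum of independent pairs, so `C` is a copula. As
`min (u ^ p) (u ^ q) = u ^ max p q` on `[0,1]`, its diagonal is a power of `u`, which gives `β`.

For a copula, disintegrating `dC` along its first margin and integrating by parts gives
`∫ C dC = 1 / 2 - ∫ ∂₁C ∂₂C`, so that both `τ` and `ρ` are Lebesgue integrals over the square. The
ridges `u ^ p k = v ^ q k` have ordered slopes and cut the square into sectors. Between the ridges
`k` and `k + 1` the copula is the monomial `u ^ (1 - p̄ k) * v ^ (q̄ k)`, where `p̄` and `q̄` are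
the partial sums, so each sector contributes an elementary integral of a monomial. The sides of the
square are treated as ridges of slopes `0` and `∞`; the two extreme sectors contribute nothing to
`τ`, and give the first fraction of `ρ`.
-/

open MeasureTheory Set

section UnitSquare

variable {C D : ℝ → ℝ → ℝ} {μ ν : Measure (ℝ × ℝ)}

theorem measurableSet_unitSquare : MeasurableSet unitSquare :=
  measurableSet_Icc.prod measurableSet_Icc

theorem restrict_unitSquare :
    (volume : Measure (ℝ × ℝ)).restrict unitSquare
      = (volume.restrict (Icc (0 : ℝ) 1)).prod (volume.restrict (Icc (0 : ℝ) 1)) := by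
  rw [Measure.prod_restrict, unitSquare, Measure.volume_eq_prod]

theorem integrableOn_unitSquare_of_mem_Icc {f : ℝ × ℝ → ℝ} (hf : Measurable f)
    (hf01 : ∀ z ∈ unitSquare, f z ∈ Icc (0 : ℝ) 1) : IntegrableOn f unitSquare := by
  have : IsFiniteMeasure ((volume : Measure (ℝ × ℝ)).restrict unitSquare) := by
    rw [restrict_unitSquare]
    infer_instance
  refine Integrable.of_mem_Icc 0 1 hf.aemeasurable ?_
  filter_upwards [ae_restrict_mem measurableSet_unitSquare] with z hz using hf01 z hz

theorem setIntegral_unitSquare {f : ℝ × ℝ → ℝ} (hf : IntegrableOn f unitSquare) :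
    ∫ z in unitSquare, f z = ∫ u in (0 : ℝ)..1, ∫ v in (0 : ℝ)..1, f (u, v) := by
  simp only [intervalIntegral.integral_of_le zero_le_one, ← integral_Icc_eq_integral_Ioc]
  exact setIntegral_prod f hf

theorem IsMeasureOf.ae_mem_unitSquare (hμ : IsMeasureOf C μ) : ∀ᵐ z ∂μ, z ∈ unitSquare :=
  hμ.carried

theorem isMeasureOf_measureOf (h : ∃ μ, IsMeasureOf C μ) : IsMeasureOf C (measureOf C) := by
  rw [measureOf, dif_pos h]
  exact h.choose_spec

/- If `(X, Y)` and `(X', Y')` are independent, then `X ⊔ X' ≤ u` and `Y ⊔ Y' ≤ v` hold together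
with probability `C u v * D u v`. -/
theorem IsMeasureOf.mul (hμ : IsMeasureOf C μ) (hν : IsMeasureOf D ν)
    (hC : ∀ u ∈ Icc (0 : ℝ) 1, ∀ v ∈ Icc (0 : ℝ) 1, 0 ≤ C u v) :
    IsMeasureOf (fun u v => C u v * D u v) ((μ.prod ν).map fun x => x.1 ⊔ x.2) := by
  have := hμ.isProbabilityMeasure
  have := hν.isProbabilityMeasure
  have hsup : Measurable fun x : (ℝ × ℝ) × (ℝ × ℝ) => x.1 ⊔ x.2 := by
    simp only [Prod.sup_def]
    fun_prop
  refine ⟨Measure.isProbabilityMeasure_map hsup.aemeasurable,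
    (ae_map_iff hsup.aemeasurable measurableSet_unitSquare).2 ?_, fun u hu v hv => ?_⟩
  · filter_upwards [Measure.quasiMeasurePreserving_fst.ae hμ.ae_mem_unitSquare,
      Measure.quasiMeasurePreserving_snd.ae hν.ae_mem_unitSquare] with x hx hx'
    exact ⟨⟨le_sup_of_le_left hx.1.1, sup_le hx.1.2 hx'.1.2⟩,
      ⟨le_sup_of_le_left hx.2.1, sup_le hx.2.2 hx'.2.2⟩⟩
  · have hpre : (fun x : (ℝ × ℝ) × (ℝ × ℝ) => x.1 ⊔ x.2) ⁻¹' (Iic u ×ˢ Iic v)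
        = (Iic u ×ˢ Iic v) ×ˢ (Iic u ×ˢ Iic v) := by
      ext x
      simp only [mem_preimage, mem_prod, mem_Iic, Prod.fst_sup, Prod.snd_sup, sup_le_iff]
      tauto
    rw [Measure.map_apply hsup (measurableSet_Iic.prod measurableSet_Iic), hpre,
      Measure.prod_prod, hμ.cdf_eq u hu v hv, hν.cdf_eq u hu v hv,
      ENNReal.ofReal_mul (hC u hu v hv)]

theorem isMeasureOf_one_dirac : IsMeasureOf (fun _ _ => 1) (Measure.dirac (0, 0)) := by
  refine ⟨inferInstance, ?_, fun u hu v hv => ?_⟩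
  · rw [Measure.dirac_apply' _ measurableSet_unitSquare.compl]
    simp [unitSquare]
  · rw [Measure.dirac_apply' _ (measurableSet_Iic.prod measurableSet_Iic)]
    simp [hu.1, hv.1]

theorem exists_isMeasureOf_finsetProd {ι : Type*} {s : Finset ι} {C : ι → ℝ → ℝ → ℝ}
    (hC : ∀ k ∈ s, ∃ μ, IsMeasureOf (C k) μ)
    (hC0 : ∀ k ∈ s, ∀ u ∈ Icc (0 : ℝ) 1, ∀ v ∈ Icc (0 : ℝ) 1, 0 ≤ C k u v) :
    ∃ μ, IsMeasureOf (fun u v => ∏ k ∈ s, C k u v) μ := by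
  induction s using Finset.cons_induction with
  | empty => exact ⟨_, isMeasureOf_one_dirac⟩
  | cons a s ha ih =>
    rw [Finset.forall_mem_cons] at hC hC0
    obtain ⟨μ, hμ⟩ := hC.1
    obtain ⟨ν, hν⟩ := ih hC.2 hC0.2
    simp only [Finset.prod_cons]
    exact ⟨_, hμ.mul hν hC0.1⟩

end UnitSquare

/-- `f` is the quantile function on `(0,1]` of the distribution function `F` of a random variable
with values in `[0,1]`, characterised by the Galois connection `f x ≤ u ↔ x ≤ F u`. -/
structure IsQuantileOf (f F : ℝ → ℝ) : Prop where
  measurable : Measurable f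
  mem_Icc : ∀ x ∈ Ioc (0 : ℝ) 1, f x ∈ Icc (0 : ℝ) 1
  le_iff : ∀ x ∈ Ioc (0 : ℝ) 1, ∀ u ∈ Icc (0 : ℝ) 1, f x ≤ u ↔ x ≤ F u
  le_one : ∀ u ∈ Icc (0 : ℝ) 1, F u ≤ 1

/- The comonotonic coupling: both coordinates are driven by the same uniform variable. -/
theorem IsQuantileOf.isMeasureOf_min {f g F G : ℝ → ℝ} (hf : IsQuantileOf f F)
    (hg : IsQuantileOf g G) :
    IsMeasureOf (fun u v => min (F u) (G v))
      ((volume.restrict (Ioc (0 : ℝ) 1)).map fun x => (f x, g x)) := by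
  have hfg : Measurable fun x => (f x, g x) := hf.measurable.prodMk hg.measurable
  have : IsProbabilityMeasure (volume.restrict (Ioc (0 : ℝ) 1)) := ⟨by simp⟩
  refine ⟨Measure.isProbabilityMeasure_map hfg.aemeasurable,
    (ae_map_iff hfg.aemeasurable measurableSet_unitSquare).2 ?_, fun u hu v hv => ?_⟩
  · filter_upwards [ae_restrict_mem measurableSet_Ioc] with x hx
    exact ⟨hf.mem_Icc x hx, hg.mem_Icc x hx⟩
  · have hIoc : (fun x => (f x, g x)) ⁻¹' (Iic u ×ˢ Iic v) ∩ Ioc 0 1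
        = Ioc 0 (min (F u) (G v)) := by
      ext x
      constructor
      · rintro ⟨⟨hxu, hxv⟩, hx⟩
        exact ⟨hx.1, le_min ((hf.le_iff x hx u hu).1 hxu) ((hg.le_iff x hx v hv).1 hxv)⟩
      · rintro ⟨hx0, hxmin⟩
        obtain ⟨hxF, hxG⟩ := le_min_iff.1 hxmin
        have hx : x ∈ Ioc (0 : ℝ) 1 := ⟨hx0, hxF.trans (hf.le_one u hu)⟩
        exact ⟨⟨(hf.le_iff x hx u hu).2 hxF, (hg.le_iff x hx v hv).2 hxG⟩, hx⟩
    have hmeas : MeasurableSet (Iic u ×ˢ Iic v) := measurableSet_Iic.prod measurableSet_Iic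
    rw [Measure.map_apply hfg hmeas, Measure.restrict_apply (hfg hmeas), hIoc, Real.volume_Ioc,
      sub_zero]

/-- `D` is the partial derivative `∂C/∂u` of a copula `C` on `[0,1]²`, in the integrated form that
determines it only up to a null set of `u` for each `v`. -/
structure IsPartialFst (C D : ℝ → ℝ → ℝ) : Prop where
  measurable : Measurable (Function.uncurry D)
  mem_Icc : ∀ u ∈ Icc (0 : ℝ) 1, ∀ v ∈ Icc (0 : ℝ) 1, D u v ∈ Icc (0 : ℝ) 1
  integral_eq : ∀ u ∈ Icc (0 : ℝ) 1, ∀ v ∈ Icc (0 : ℝ) 1, ∫ t in (0 : ℝ)..u, D t v = C u v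

namespace IsPartialFst

variable {C C' D D' : ℝ → ℝ → ℝ} {v : ℝ}

theorem measurable_left (hD : IsPartialFst C D) (v : ℝ) : Measurable fun u => D u v :=
  hD.measurable.comp measurable_prodMk_right

theorem integrableOn (hD : IsPartialFst C D) (hv : v ∈ Icc (0 : ℝ) 1) :
    IntegrableOn (fun u => D u v) (Icc 0 1) := by
  refine Integrable.of_mem_Icc 0 1 (hD.measurable_left v).aemeasurable ?_
  filter_upwards [ae_restrict_mem measurableSet_Icc] with u hu using hD.mem_Icc u hu v hv

theorem integrableOn_mul (hD : IsPartialFst C D) (hD' : IsPartialFst C' D') :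
    IntegrableOn (fun z : ℝ × ℝ => D z.1 z.2 * D' z.2 z.1) unitSquare := by
  refine integrableOn_unitSquare_of_mem_Icc
    (hD.measurable.mul (hD'.measurable.comp measurable_swap)) fun z hz => ?_
  have h := hD.mem_Icc z.1 hz.1 z.2 hz.2
  have h' := hD'.mem_Icc z.2 hz.2 z.1 hz.1
  exact ⟨mul_nonneg h.1 h'.1, mul_le_one₀ h.2 h'.1 h'.2⟩

end IsPartialFst

namespace IsMeasureOf

variable {C : ℝ → ℝ → ℝ} {μ : Measure (ℝ × ℝ)} {g f : ℝ → ℝ} {s : ℝ}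

theorem measure_Iic_prod_Iic_of_nonneg (hμ : IsMeasureOf C μ) {a : ℝ} (ha : 0 ≤ a)
    (hs : s ∈ Icc (0 : ℝ) 1) : μ (Iic a ×ˢ Iic s) = ENNReal.ofReal (C (min 1 a) s) := by
  rw [← hμ.cdf_eq (min 1 a) ⟨le_min zero_le_one ha, min_le_left _ _⟩ s hs]
  refine measure_congr ?_
  filter_upwards [hμ.ae_mem_unitSquare] with z hz
  have hiff : z.1 ∈ Iic a ↔ z.1 ∈ Iic (min 1 a) := by simp [hz.1.2]
  exact propext (and_congr_left' hiff)

theorem measure_Iic_prod_of_neg (hμ : IsMeasureOf C μ) {a : ℝ} (ha : a < 0) (t : Set ℝ) :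
    μ (Iic a ×ˢ t) = 0 :=
  measure_mono_null (fun _ hz (hz' : _ ∈ unitSquare) => ha.not_ge (hz'.1.1.trans hz.1)) hμ.carried

/- The density `g` of the part of `dC` below height `s` is the conditional distribution function
`u ↦ P (V ≤ s | U = u)`. -/
theorem map_fst_restrict_le (hμ : IsMeasureOf C μ) (hs : s ∈ Icc (0 : ℝ) 1)
    (hg : IntegrableOn g (Icc 0 1)) (hg0 : ∀ t ∈ Icc (0 : ℝ) 1, 0 ≤ g t)
    (hgC : ∀ a ∈ Icc (0 : ℝ) 1, ∫ t in (0 : ℝ)..a, g t = C a s) :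
    (μ.restrict {z | z.2 ≤ s}).map Prod.fst
      = (volume.restrict (Icc (0 : ℝ) 1)).withDensity fun t => ENNReal.ofReal (g t) := by
  have := hμ.isProbabilityMeasure
  refine Measure.ext_of_Iic _ _ fun a => ?_
  have hpre : Prod.fst ⁻¹' Iic a ∩ {z : ℝ × ℝ | z.2 ≤ s} = Iic a ×ˢ Iic s := rfl
  have hIcc : Iic a ∩ Icc (0 : ℝ) 1 = Icc 0 (min 1 a) := by
    ext t
    simp only [mem_inter_iff, mem_Iic, mem_Icc, le_min_iff]
    tauto
  rw [Measure.map_apply measurable_fst measurableSet_Iic,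
    Measure.restrict_apply (measurable_fst measurableSet_Iic), hpre,
    withDensity_apply _ measurableSet_Iic, Measure.restrict_restrict measurableSet_Iic, hIcc]
  rcases lt_or_ge a 0 with ha | ha
  · rw [hμ.measure_Iic_prod_of_neg ha, Icc_eq_empty ((min_le_right 1 a).trans_lt ha).not_ge]
    simp
  · have ha' : min 1 a ∈ Icc (0 : ℝ) 1 := ⟨le_min zero_le_one ha, min_le_left _ _⟩
    have hsub : Icc 0 (min 1 a) ⊆ Icc (0 : ℝ) 1 := Icc_subset_Icc_right ha'.2
    rw [hμ.measure_Iic_prod_Iic_of_nonneg ha hs, ← hgC _ ha', intervalIntegral.integral_of_le ha'.1,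
      ← integral_Icc_eq_integral_Ioc, ofReal_integral_eq_lintegral_ofReal (hg.mono_set hsub)]
    filter_upwards [ae_restrict_mem measurableSet_Icc] with t ht using hg0 t (hsub ht)

theorem setIntegral_le_comp_fst (hμ : IsMeasureOf C μ) (hs : s ∈ Icc (0 : ℝ) 1)
    (hg : IntegrableOn g (Icc 0 1)) (hgm : Measurable g) (hg0 : ∀ t ∈ Icc (0 : ℝ) 1, 0 ≤ g t)
    (hgC : ∀ a ∈ Icc (0 : ℝ) 1, ∫ t in (0 : ℝ)..a, g t = C a s) (hf : Measurable f) :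
    ∫ z in {z | z.2 ≤ s}, f z.1 ∂μ = ∫ u in Icc 0 1, g u * f u := by
  rw [← integral_map measurable_fst.aemeasurable hf.aestronglyMeasurable,
    hμ.map_fst_restrict_le hs hg hg0 hgC,
    integral_withDensity_eq_integral_toReal_smul hgm.ennreal_ofReal (by simp)]
  refine setIntegral_congr_fun measurableSet_Icc fun u hu => ?_
  simp only [ENNReal.toReal_ofReal (hg0 u hu), smul_eq_mul]

theorem integral_fst (hμ : IsMeasureOf C μ) (hC1 : ∀ u ∈ Icc (0 : ℝ) 1, C u 1 = u) :
    ∫ z, z.1 ∂μ = 1 / 2 := by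
  have hle : ∀ᵐ z ∂μ, z ∈ {z : ℝ × ℝ | z.2 ≤ 1} := by
    filter_upwards [hμ.ae_mem_unitSquare] with z hz using hz.2.2
  rw [← Measure.restrict_eq_self_of_ae_mem hle,
    hμ.setIntegral_le_comp_fst (g := fun _ => 1) (f := fun u => u) ⟨zero_le_one, le_rfl⟩ (by simp)
      measurable_const (fun _ _ => zero_le_one) (fun a ha => by simp [hC1 a ha]) measurable_id,
    integral_Icc_eq_integral_Ioc, ← intervalIntegral.integral_of_le zero_le_one]
  simp

end IsMeasureOf

theorem IsPartialFst.eq_sub_setIntegral_indicator {C D : ℝ → ℝ → ℝ}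
    (hD : IsPartialFst (fun v u => C u v) D) (hC1 : ∀ u ∈ Icc (0 : ℝ) 1, C u 1 = u) {z : ℝ × ℝ}
    (hz : z ∈ unitSquare) :
    C z.1 z.2 = z.1 - ∫ s in Icc 0 1, {z | z.2 ≤ s}.indicator (fun z => D s z.1) z := by
  have hint (a b : ℝ) (ha : a ∈ Icc (0 : ℝ) 1) (hb : b ∈ Icc (0 : ℝ) 1) :
      IntervalIntegrable (fun s => D s z.1) volume a b :=
    ((hD.integrableOn hz.1).mono_set (uIcc_subset_Icc ha hb)).intervalIntegrable
  have hind : (fun s => {z : ℝ × ℝ | z.2 ≤ s}.indicator (fun z => D s z.1) z)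
      = (Ici z.2).indicator fun s => D s z.1 := rfl
  have hIcc : Icc (0 : ℝ) 1 ∩ Ici z.2 = Icc z.2 1 := by
    ext t
    simp only [mem_inter_iff, mem_Ici]
    exact ⟨fun h => ⟨h.2, h.1.2⟩, fun h => ⟨⟨hz.2.1.trans h.1, h.2⟩, h.1⟩⟩
  have h0 : (0 : ℝ) ∈ Icc (0 : ℝ) 1 := ⟨le_rfl, zero_le_one⟩
  have h1 : (1 : ℝ) ∈ Icc (0 : ℝ) 1 := ⟨zero_le_one, le_rfl⟩
  rw [hind, setIntegral_indicator measurableSet_Ici, hIcc, integral_Icc_eq_integral_Ioc,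
    ← intervalIntegral.integral_of_le hz.2.2,
    ← intervalIntegral.integral_interval_sub_left (hint 0 1 h0 h1) (hint 0 z.2 h0 hz.2),
    hD.integral_eq 1 h1 z.1 hz.1, hD.integral_eq z.2 hz.2 z.1 hz.1, hC1 z.1 hz.1, sub_sub_cancel]

theorem IsPartialFst.integrable_indicator {C C' D : ℝ → ℝ → ℝ} {μ : Measure (ℝ × ℝ)}
    (hD : IsPartialFst C' D) (hμ : IsMeasureOf C μ) :
    Integrable (Function.uncurry fun (z : ℝ × ℝ) s => {z | z.2 ≤ s}.indicator (fun z => D s z.1) z)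
      (μ.prod (volume.restrict (Icc (0 : ℝ) 1))) := by
  have hmeas : Measurable (Function.uncurry fun (z : ℝ × ℝ) s =>
      {z | z.2 ≤ s}.indicator (fun z => D s z.1) z) :=
    Measurable.indicator
      (hD.measurable.comp (measurable_snd.prodMk (measurable_fst.comp measurable_fst)))
      (measurableSet_le (measurable_snd.comp measurable_fst) measurable_snd)
  have := hμ.isProbabilityMeasure
  refine Integrable.of_mem_Icc 0 1 hmeas.aemeasurable ?_
  filter_upwards [Measure.quasiMeasurePreserving_fst.ae hμ.ae_mem_unitSquare,
    Measure.quasiMeasurePreserving_snd.ae (ae_restrict_mem measurableSet_Icc)] with x hx hs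
  have hmem := hD.mem_Icc x.2 hs x.1.1 hx.1
  exact ⟨indicator_nonneg (fun _ _ => hmem.1) _,
    indicator_le' (fun _ _ => hmem.2) (fun _ _ => zero_le_one) _⟩

/- Integration by parts: write `C u v = u - ∫ s in v..1, ∂₂C u s` and integrate each
`z ↦ ∂₂C z.1 s` over `{z | z.2 ≤ s}`, where the first margin of `dC` has density `∂₁C · s`. -/
theorem IsMeasureOf.setIntegral_self {C D₁ D₂ : ℝ → ℝ → ℝ} {μ : Measure (ℝ × ℝ)}
    (hμ : IsMeasureOf C μ) (hC1 : ∀ u ∈ Icc (0 : ℝ) 1, C u 1 = u) (hD₁ : IsPartialFst C D₁)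
    (hD₂ : IsPartialFst (fun v u => C u v) D₂) :
    ∫ z in unitSquare, C z.1 z.2 ∂μ
      = 1 / 2 - ∫ z in unitSquare, D₁ z.1 z.2 * D₂ z.2 z.1 := by
  have := hμ.isProbabilityMeasure
  set F : ℝ × ℝ → ℝ → ℝ := fun z s => {z | z.2 ≤ s}.indicator (fun z => D₂ s z.1) z
  have hF_int : Integrable (Function.uncurry F) (μ.prod (volume.restrict (Icc (0 : ℝ) 1))) :=
    hD₂.integrable_indicator hμ
  have hF_left : Integrable (fun z => ∫ s in Icc 0 1, F z s) μ := hF_int.integral_prod_left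
  have hfst_int : Integrable (fun z : ℝ × ℝ => z.1) μ := by
    refine Integrable.of_mem_Icc 0 1 measurable_fst.aemeasurable ?_
    filter_upwards [hμ.ae_mem_unitSquare] with z hz using hz.1
  calc ∫ z in unitSquare, C z.1 z.2 ∂μ
      = ∫ z, (z.1 - ∫ s in Icc 0 1, F z s) ∂μ := by
        rw [Measure.restrict_eq_self_of_ae_mem hμ.ae_mem_unitSquare]
        refine integral_congr_ae ?_
        filter_upwards [hμ.ae_mem_unitSquare] with z hz
          using hD₂.eq_sub_setIntegral_indicator hC1 hz
    _ = 1 / 2 - ∫ s in Icc 0 1, ∫ z, F z s ∂μ := by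
        rw [integral_sub hfst_int hF_left, hμ.integral_fst hC1,
          integral_integral_swap hF_int]
    _ = 1 / 2 - ∫ s in Icc 0 1, ∫ u in Icc 0 1, D₁ u s * D₂ s u := by
        congr 1
        refine setIntegral_congr_fun measurableSet_Icc fun s hs => ?_
        simp only [F]
        rw [integral_indicator (measurableSet_le measurable_snd measurable_const)]
        exact hμ.setIntegral_le_comp_fst hs (hD₁.integrableOn hs) (hD₁.measurable_left s)
          (fun u hu => (hD₁.mem_Icc u hu s hs).1) (fun a ha => hD₁.integral_eq a ha s hs)
          (hD₂.measurable.comp measurable_prodMk_left)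
    _ = 1 / 2 - ∫ z in unitSquare, D₁ z.1 z.2 * D₂ z.2 z.1 := by
        rw [restrict_unitSquare, integral_prod_symm]
        rw [← restrict_unitSquare]
        exact hD₁.integrableOn_mul hD₂

/-- The quantile function of the distribution function `v ↦ v ^ q` on `[0,1]`: the least `v` with
`x ≤ v ^ q`. For `q = 0` that is `0`, the distribution function being constantly `1`. -/
noncomputable def rpowQuantile (q x : ℝ) : ℝ := if q = 0 then 0 else x ^ q⁻¹

section RpowQuantile

variable {q x : ℝ}

theorem rpowQuantile_nonneg (hx : 0 ≤ x) : 0 ≤ rpowQuantile q x := by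
  unfold rpowQuantile
  split_ifs
  exacts [le_rfl, Real.rpow_nonneg hx _]

theorem isQuantileOf_rpowQuantile (hq : 0 ≤ q) : IsQuantileOf (rpowQuantile q) (· ^ q) := by
  have hle (x : ℝ) (hx : x ∈ Ioc (0 : ℝ) 1) (u : ℝ) (hu : u ∈ Icc (0 : ℝ) 1) :
      rpowQuantile q x ≤ u ↔ x ≤ u ^ q := by
    unfold rpowQuantile
    split_ifs with h
    · simp [h, hu.1, hx.2]
    · exact Real.rpow_inv_le_iff_of_pos hx.1.le hu.1 (hq.lt_of_ne' h)
  refine ⟨?_, fun x hx => ⟨rpowQuantile_nonneg hx.1.le, ?_⟩, hle,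
    fun u hu => Real.rpow_le_one hu.1 hu.2 hq⟩
  · unfold rpowQuantile
    split_ifs <;> fun_prop
  · exact (hle x hx 1 ⟨zero_le_one, le_rfl⟩).2 (hx.2.trans_eq (Real.one_rpow q).symm)

end RpowQuantile

section Liebscher

variable {K : ℕ} {p q : ℕ → ℝ} {u v : ℝ}

theorem liebscherCL_swap (K : ℕ) (p q : ℕ → ℝ) (u v : ℝ) :
    liebscherCL K p q u v = liebscherCL K q p v u :=
  Finset.prod_congr rfl fun _ _ => min_comm _ _

theorem measurable_liebscherCL : Measurable (Function.uncurry (liebscherCL K p q)) := by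
  unfold liebscherCL Function.uncurry
  fun_prop

theorem liebscherCL_nonneg (hu : 0 ≤ u) (hv : 0 ≤ v) : 0 ≤ liebscherCL K p q u v :=
  Finset.prod_nonneg fun _ _ => le_min (Real.rpow_nonneg hu _) (Real.rpow_nonneg hv _)

theorem prod_rpow_eq_self (hp : ∀ k ∈ Finset.Icc 1 K, 0 ≤ p k)
    (hp1 : ∑ k ∈ Finset.Icc 1 K, p k = 1) (hu : 0 ≤ u) : ∏ k ∈ Finset.Icc 1 K, u ^ p k = u := by
  rw [← Real.rpow_sum_of_nonneg hu hp, hp1, Real.rpow_one]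

theorem liebscherCL_le_left (hp : ∀ k ∈ Finset.Icc 1 K, 0 ≤ p k)
    (hp1 : ∑ k ∈ Finset.Icc 1 K, p k = 1) (hu : 0 ≤ u) (hv : 0 ≤ v) :
    liebscherCL K p q u v ≤ u :=
  calc liebscherCL K p q u v ≤ ∏ k ∈ Finset.Icc 1 K, u ^ p k :=
        Finset.prod_le_prod (fun _ _ => le_min (Real.rpow_nonneg hu _) (Real.rpow_nonneg hv _))
          fun _ _ => min_le_left _ _
    _ = u := prod_rpow_eq_self hp hp1 hu

theorem liebscherCL_zero_left (hp : ∀ k ∈ Finset.Icc 1 K, 0 ≤ p k)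
    (hp1 : ∑ k ∈ Finset.Icc 1 K, p k = 1) (hv : 0 ≤ v) : liebscherCL K p q 0 v = 0 :=
  le_antisymm (liebscherCL_le_left hp hp1 le_rfl hv) (liebscherCL_nonneg le_rfl hv)

theorem liebscherCL_one_right (hp : ∀ k ∈ Finset.Icc 1 K, 0 ≤ p k)
    (hp1 : ∑ k ∈ Finset.Icc 1 K, p k = 1) (hu : u ∈ Icc (0 : ℝ) 1) :
    liebscherCL K p q u 1 = u :=
  calc liebscherCL K p q u 1 = ∏ k ∈ Finset.Icc 1 K, u ^ p k :=
        Finset.prod_congr rfl fun k hk => by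
          rw [Real.one_rpow, min_eq_left (Real.rpow_le_one hu.1 hu.2 (hp k hk))]
    _ = u := prod_rpow_eq_self hp hp1 hu.1

theorem exists_isMeasureOf_liebscherCL (hp : ∀ k ∈ Finset.Icc 1 K, 0 ≤ p k)
    (hq : ∀ k ∈ Finset.Icc 1 K, 0 ≤ q k) : ∃ μ, IsMeasureOf (liebscherCL K p q) μ :=
  exists_isMeasureOf_finsetProd
    (fun k hk => ⟨_, (isQuantileOf_rpowQuantile (hp k hk)).isMeasureOf_min
      (isQuantileOf_rpowQuantile (hq k hk))⟩)
    fun _ _ _ hu _ hv => le_min (Real.rpow_nonneg hu.1 _) (Real.rpow_nonneg hv.1 _)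

theorem isCopula_liebscherCL (hp : ∀ k ∈ Finset.Icc 1 K, 0 ≤ p k)
    (hq : ∀ k ∈ Finset.Icc 1 K, 0 ≤ q k) (hp1 : ∑ k ∈ Finset.Icc 1 K, p k = 1)
    (hq1 : ∑ k ∈ Finset.Icc 1 K, q k = 1) : IsCopula (liebscherCL K p q) := by
  refine ⟨exists_isMeasureOf_liebscherCL hp hq, fun u hu => liebscherCL_one_right hp hp1 hu,
    fun v hv => ?_⟩
  rw [liebscherCL_swap]
  exact liebscherCL_one_right hq hq1 hv

theorem liebscherCL_diag (hu : u ∈ Ioc (0 : ℝ) 1) :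
    liebscherCL K p q u u = u ^ ∑ k ∈ Finset.Icc 1 K, max (p k) (q k) := by
  rw [Real.rpow_sum_of_pos hu.1]
  exact Finset.prod_congr rfl fun k _ =>
    (Real.antitone_rpow_of_base_le_one hu.1 hu.2).map_max.symm

theorem blomqvistBeta_liebscherCL (hp1 : ∑ k ∈ Finset.Icc 1 K, p k = 1)
    (hq1 : ∑ k ∈ Finset.Icc 1 K, q k = 1) :
    blomqvistBeta (liebscherCL K p q)
      = (2 : ℝ) ^ (∑ k ∈ Finset.Icc 1 K, min (p k) (q k)) - 1 := by
  have hsum : ∑ k ∈ Finset.Icc 1 K, max (p k) (q k)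
      = 2 - ∑ k ∈ Finset.Icc 1 K, min (p k) (q k) := by
    rw [eq_sub_iff_add_eq, ← Finset.sum_add_distrib]
    simp only [max_add_min, Finset.sum_add_distrib, hp1, hq1]
    norm_num
  rw [blomqvistBeta, liebscherCL_diag (by norm_num), hsum, one_div, Real.inv_rpow zero_le_two,
    ← Real.rpow_neg zero_le_two, neg_sub, Real.rpow_sub two_pos, Real.rpow_two]
  ring

/-- The partial derivative of `liebscherCL K p q` in its first variable off the ridges
`u ^ p k = v ^ q k`. The partial derivative in the second variable is `liebscherDeriv K q p v u`. -/
noncomputable def liebscherDeriv (K : ℕ) (p q : ℕ → ℝ) (u v : ℝ) : ℝ :=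
  liebscherCL K p q u v * ((∑ k ∈ Finset.Icc 1 K with u ^ p k < v ^ q k, p k) / u)

theorem hasDerivAt_min_rpow {a c : ℝ} (hu : 0 < u) (h : u ^ a = c → a = 0) :
    HasDerivAt (fun x => min (x ^ a) c) (min (u ^ a) c * ((if u ^ a < c then a else 0) / u)) u := by
  have hpow := Real.hasDerivAt_rpow_const (p := a) (Or.inl hu.ne')
  rcases lt_trichotomy (u ^ a) c with hlt | heq | hgt
  · rw [if_pos hlt, min_eq_left hlt.le]
    refine (hpow.congr_of_eventuallyEq ?_).congr_deriv (by rw [Real.rpow_sub_one hu.ne']; ring)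
    filter_upwards [hpow.continuousAt.eventually_lt continuousAt_const hlt] with x hx
      using min_eq_left hx.le
  · simpa [h heq] using hasDerivAt_const u (min 1 c)
  · rw [if_neg hgt.not_gt, zero_div, mul_zero]
    refine (hasDerivAt_const u c).congr_of_eventuallyEq ?_
    filter_upwards [continuousAt_const.eventually_lt hpow.continuousAt hgt] with x hx
      using min_eq_right hx.le

theorem hasDerivAt_liebscherCL (hu : 0 < u)
    (h : ∀ k ∈ Finset.Icc 1 K, u ^ p k = v ^ q k → p k = 0) :
    HasDerivAt (fun x => liebscherCL K p q x v) (liebscherDeriv K p q u v) u := by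
  refine (HasDerivAt.fun_finsetProd fun k hk => hasDerivAt_min_rpow hu (h k hk)).congr_deriv ?_
  rw [liebscherDeriv, Finset.sum_filter, Finset.sum_div, Finset.mul_sum]
  refine Finset.sum_congr rfl fun k hk => ?_
  rw [smul_eq_mul, ← mul_assoc, Finset.prod_erase_mul _ _ hk, liebscherCL]

theorem measurable_liebscherDeriv : Measurable (Function.uncurry (liebscherDeriv K p q)) := by
  refine measurable_liebscherCL.mul (Measurable.div ?_ measurable_fst)
  simp only [Finset.sum_filter]
  exact Finset.measurable_fun_sum _ fun k _ => Measurable.ite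
    (measurableSet_lt (measurable_fst.pow_const _) (measurable_snd.pow_const _))
    measurable_const measurable_const

theorem liebscherDeriv_mem_Icc (hp : ∀ k ∈ Finset.Icc 1 K, 0 ≤ p k)
    (hp1 : ∑ k ∈ Finset.Icc 1 K, p k = 1) (hu : 0 ≤ u) (hv : 0 ≤ v) :
    liebscherDeriv K p q u v ∈ Icc (0 : ℝ) 1 := by
  have hsum_nonneg : 0 ≤ ∑ k ∈ Finset.Icc 1 K with u ^ p k < v ^ q k, p k :=
    Finset.sum_nonneg fun k hk => hp k (Finset.mem_of_mem_filter k hk)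
  have hsum_le : ∑ k ∈ Finset.Icc 1 K with u ^ p k < v ^ q k, p k ≤ 1 :=
    hp1 ▸ Finset.sum_le_sum_of_subset_of_nonneg (Finset.filter_subset _ _) fun k hk _ => hp k hk
  have hC_nonneg : 0 ≤ liebscherCL K p q u v := liebscherCL_nonneg hu hv
  refine ⟨mul_nonneg hC_nonneg (div_nonneg hsum_nonneg hu), ?_⟩
  rw [liebscherDeriv, mul_div_assoc']
  exact div_le_one_of_le₀ ((mul_le_of_le_one_right hC_nonneg hsum_le).trans
    (liebscherCL_le_left hp hp1 hu hv)) hu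

theorem countable_setOf_rpow_eq (K : ℕ) (p q : ℕ → ℝ) (v : ℝ) :
    {x : ℝ | 0 < x ∧ ∃ k ∈ Finset.Icc 1 K, p k ≠ 0 ∧ x ^ p k = v ^ q k}.Countable := by
  refine ((Finset.Icc 1 K).countable_toSet.image fun k => (v ^ q k) ^ (p k)⁻¹).mono ?_
  rintro x ⟨hx, k, hk, hpk, hxk⟩
  exact ⟨k, hk, (congrArg (· ^ (p k)⁻¹) hxk).symm.trans (Real.rpow_rpow_inv hx.le hpk)⟩

theorem integral_liebscherDeriv (hp : ∀ k ∈ Finset.Icc 1 K, 0 ≤ p k)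
    (hp1 : ∑ k ∈ Finset.Icc 1 K, p k = 1) (hu : 0 ≤ u) (hv : 0 ≤ v) :
    ∫ t in (0 : ℝ)..u, liebscherDeriv K p q t v = liebscherCL K p q u v := by
  have hcont : Continuous fun x => liebscherCL K p q x v :=
    continuous_finsetProd _ fun k hk => (Real.continuous_rpow_const (hp k hk)).min continuous_const
  have hderiv : ∀ x ∈ Ioo 0 u \ {x | 0 < x ∧ ∃ k ∈ Finset.Icc 1 K, p k ≠ 0 ∧ x ^ p k = v ^ q k},
      HasDerivAt (fun x => liebscherCL K p q x v) (liebscherDeriv K p q x v) x := by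
    rintro x ⟨hx, hxs⟩
    refine hasDerivAt_liebscherCL hx.1 fun k hk hxk => ?_
    by_contra hpk
    exact hxs ⟨hx.1, k, hk, hpk, hxk⟩
  have hint : IntervalIntegrable (fun t => liebscherDeriv K p q t v) volume 0 u := by
    rw [intervalIntegrable_iff_integrableOn_Ioc_of_le hu]
    refine Integrable.of_mem_Icc 0 1
      (measurable_liebscherDeriv.comp measurable_prodMk_right).aemeasurable ?_
    filter_upwards [ae_restrict_mem measurableSet_Ioc] with t ht
      using liebscherDeriv_mem_Icc hp hp1 ht.1.le hv
  rw [integral_eq_of_hasDerivAt_off_countable_of_le _ _ hu (countable_setOf_rpow_eq K p q v)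
    hcont.continuousOn hderiv hint, liebscherCL_zero_left hp hp1 hv, sub_zero]

theorem isPartialFst_liebscherDeriv (hp : ∀ k ∈ Finset.Icc 1 K, 0 ≤ p k)
    (hp1 : ∑ k ∈ Finset.Icc 1 K, p k = 1) :
    IsPartialFst (liebscherCL K p q) (liebscherDeriv K p q) where
  measurable := measurable_liebscherDeriv
  mem_Icc _ hu _ hv := liebscherDeriv_mem_Icc hp hp1 hu.1 hv.1
  integral_eq _ hu _ hv := integral_liebscherDeriv hp hp1 hu.1 hv.1

theorem kendallTau_liebscherCL_eq_integral (hp : ∀ k ∈ Finset.Icc 1 K, 0 ≤ p k)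
    (hq : ∀ k ∈ Finset.Icc 1 K, 0 ≤ q k) (hp1 : ∑ k ∈ Finset.Icc 1 K, p k = 1)
    (hq1 : ∑ k ∈ Finset.Icc 1 K, q k = 1) :
    kendallTau (liebscherCL K p q) = 1 - 4 * ∫ u in (0 : ℝ)..1, ∫ v in (0 : ℝ)..1,
      liebscherDeriv K p q u v * liebscherDeriv K q p v u := by
  have hD₁ : IsPartialFst (liebscherCL K p q) (liebscherDeriv K p q) :=
    isPartialFst_liebscherDeriv hp hp1
  have hD₂ : IsPartialFst (fun v u => liebscherCL K p q u v) (liebscherDeriv K q p) := by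
    simp only [liebscherCL_swap K p q]
    exact isPartialFst_liebscherDeriv hq hq1
  rw [kendallTau, (isMeasureOf_measureOf (exists_isMeasureOf_liebscherCL hp hq)).setIntegral_self
    (fun u hu => liebscherCL_one_right hp hp1 hu) hD₁ hD₂,
    setIntegral_unitSquare (hD₁.integrableOn_mul hD₂)]
  ring

theorem spearmanRho_liebscherCL_eq_integral (hp : ∀ k ∈ Finset.Icc 1 K, 0 ≤ p k)
    (hp1 : ∑ k ∈ Finset.Icc 1 K, p k = 1) :
    spearmanRho (liebscherCL K p q)
      = 12 * (∫ u in (0 : ℝ)..1, ∫ v in (0 : ℝ)..1, liebscherCL K p q u v) - 3 := by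
  rw [spearmanRho, setIntegral_unitSquare]
  exact integrableOn_unitSquare_of_mem_Icc measurable_liebscherCL fun z hz =>
    ⟨liebscherCL_nonneg hz.1.1 hz.2.1,
      (liebscherCL_le_left hp hp1 hz.1.1 hz.2.1).trans hz.1.2⟩

end Liebscher

/-- The curve `v ^ q = u ^ p` of the unit square, as the graph of a function of `u`. For `q = 0`
it is the horizontal axis. -/
noncomputable def ridge (p q u : ℝ) : ℝ := rpowQuantile q (u ^ p)

/-- The integral of `u ^ (a - 1) * v ^ (b - 1)` over the part of the unit square between the ridges
of slopes `p / q ≤ p' / q'`, in a form without division by `q` or `q'`; see `integral_sector`. -/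
noncomputable def sectorMass (a b p q p' q' : ℝ) : ℝ :=
  (p' * q - p * q') / ((b * p + a * q) * (b * p' + a * q'))

/-- The integral of the Liebscher copula over the two extreme parts of the unit square, above the
ridge of slope `p / q` (where it equals `u`) and below the ridge of slope `p' / q'` (where it equals
`v`); see `sectorMass_axes_add`. -/
noncomputable def cornerMass (p q p' q' : ℝ) : ℝ :=
  (q * q' + p * q' + p * p') / ((2 * q + p) * (q' + 2 * p'))

section Ridge

variable {p q p' q' u v a b : ℝ}

theorem ridge_nonneg (hu : 0 ≤ u) : 0 ≤ ridge p q u :=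
  rpowQuantile_nonneg (Real.rpow_nonneg hu p)

theorem ridge_zero_right (p u : ℝ) : ridge p 0 u = 0 :=
  if_pos rfl

theorem ridge_zero_left (hq : q ≠ 0) (u : ℝ) : ridge 0 q u = 1 := by
  rw [ridge, rpowQuantile, if_neg hq, Real.rpow_zero, Real.one_rpow]

theorem ridge_of_ne_zero (hq : q ≠ 0) (hu : 0 ≤ u) : ridge p q u = u ^ (p / q) := by
  rw [ridge, rpowQuantile, if_neg hq, div_eq_mul_inv, Real.rpow_mul hu]

theorem rpow_lt_of_lt_ridge (hq : 0 ≤ q) (hu : 0 < u) (hv : 0 < v) (h : v < ridge p q u) :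
    v ^ q < u ^ p := by
  rcases eq_or_ne q 0 with rfl | hq0
  · exact absurd (h.trans_eq (ridge_zero_right p u)) hv.not_gt
  · rwa [ridge, rpowQuantile, if_neg hq0,
      Real.lt_rpow_inv_iff_of_pos hv.le (Real.rpow_nonneg hu.le _) (hq.lt_of_ne' hq0)] at h

theorem lt_rpow_of_ridge_lt (hp : 0 ≤ p) (hq : 0 ≤ q) (hpq : ¬(p = 0 ∧ q = 0))
    (hu : u ∈ Ioo (0 : ℝ) 1) (hv : 0 < v) (h : ridge p q u < v) : u ^ p < v ^ q := by
  rcases eq_or_ne q 0 with rfl | hq0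
  · rw [Real.rpow_zero]
    exact Real.rpow_lt_one hu.1.le hu.2 (hp.lt_of_ne' fun hp0 => hpq ⟨hp0, rfl⟩)
  · rwa [ridge, rpowQuantile, if_neg hq0,
      Real.rpow_inv_lt_iff_of_pos (Real.rpow_nonneg hu.1.le _) hv.le (hq.lt_of_ne' hq0)] at h

theorem ridge_le_ridge_of_ratio_le (hp : 0 ≤ p) (hq : 0 ≤ q) (hpq : ¬(p = 0 ∧ q = 0))
    (hp' : 0 ≤ p') (hq' : 0 ≤ q')
    (h : ENNReal.ofReal p / ENNReal.ofReal q ≤ ENNReal.ofReal p' / ENNReal.ofReal q')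
    (hu : u ∈ Ioo (0 : ℝ) 1) : ridge p' q' u ≤ ridge p q u := by
  rcases hq'.eq_or_lt' with rfl | hq'0
  · exact (ridge_zero_right p' u).trans_le (ridge_nonneg hu.1.le)
  rcases hq.eq_or_lt' with rfl | hq0
  · have hp0 : 0 < p := hp.lt_of_ne' fun hp0 => hpq ⟨hp0, rfl⟩
    rw [ENNReal.ofReal_zero, ENNReal.div_zero (ENNReal.ofReal_pos.2 hp0).ne', top_le_iff,
      ← ENNReal.ofReal_div_of_pos hq'0] at h
    exact absurd h ENNReal.ofReal_ne_top
  · rw [← ENNReal.ofReal_div_of_pos hq0, ← ENNReal.ofReal_div_of_pos hq'0,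
      ENNReal.ofReal_le_ofReal_iff (div_nonneg hp' hq')] at h
    rw [ridge_of_ne_zero hq0.ne' hu.1.le, ridge_of_ne_zero hq'0.ne' hu.1.le]
    exact Real.rpow_le_rpow_of_exponent_ge hu.1 hu.2.le h

theorem mul_add_mul_pos (ha : 0 < a) (hb : 0 < b) (hp : 0 ≤ p) (hq : 0 ≤ q)
    (hpq : ¬(p = 0 ∧ q = 0)) : 0 < b * p + a * q := by
  rcases hp.eq_or_lt' with rfl | hp0
  · have hq0 : 0 < q := hq.lt_of_ne' fun hq0 => hpq ⟨rfl, hq0⟩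
    positivity
  · positivity

theorem rpow_mul_ridge_rpow (hq : q ≠ 0) (hu : 0 < u) :
    u ^ (a - 1) * ridge p q u ^ b = u ^ (a - 1 + p / q * b) := by
  rw [ridge_of_ne_zero hq hu.le, ← Real.rpow_mul hu.le, ← Real.rpow_add hu]

theorem intervalIntegrable_rpow_mul_ridge_rpow (hp : 0 ≤ p) (hq : 0 ≤ q) (ha : 0 < a)
    (hb : 0 < b) : IntervalIntegrable (fun u => u ^ (a - 1) * ridge p q u ^ b) volume 0 1 := by
  rcases eq_or_ne q 0 with rfl | hq0
  · simp [ridge_zero_right, Real.zero_rpow hb.ne']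
  · have hexp : -1 < a - 1 + p / q * b := by
      have := mul_nonneg (div_nonneg hp hq) hb.le
      linarith
    refine (intervalIntegral.intervalIntegrable_rpow' hexp).congr_uIoo fun u hu => ?_
    rw [uIoo_of_le zero_le_one] at hu
    exact (rpow_mul_ridge_rpow hq0 hu.1).symm

theorem integral_rpow_mul_ridge_rpow (hp : 0 ≤ p) (hq : 0 ≤ q) (ha : 0 < a) (hb : 0 < b) :
    ∫ u in (0 : ℝ)..1, u ^ (a - 1) * ridge p q u ^ b = q / (b * p + a * q) := by
  rcases hq.eq_or_lt' with rfl | hq0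
  · simp [ridge_zero_right, Real.zero_rpow hb.ne']
  · have hexp : 0 < a - 1 + p / q * b + 1 := by
      have := mul_nonneg (div_nonneg hp hq) hb.le
      linarith
    have hexp_eq : a - 1 + p / q * b + 1 = (b * p + a * q) / q := by
      field_simp
      ring
    rw [intervalIntegral.integral_congr_Ioo_of_le zero_le_one
      fun u hu => rpow_mul_ridge_rpow hq0.ne' hu.1,
      integral_rpow (Or.inl (by linarith)), Real.one_rpow, Real.zero_rpow hexp.ne', sub_zero,
      hexp_eq, one_div_div]

theorem integral_between_ridges (u : ℝ) (hb : 0 < b) :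
    ∫ v in ridge p' q' u..ridge p q u, u ^ (a - 1) * v ^ (b - 1)
      = b⁻¹ * (u ^ (a - 1) * ridge p q u ^ b - u ^ (a - 1) * ridge p' q' u ^ b) := by
  rw [intervalIntegral.integral_const_mul, integral_rpow (Or.inl (by linarith)), sub_add_cancel]
  ring

theorem intervalIntegrable_sector (hp : 0 ≤ p) (hq : 0 ≤ q) (hp' : 0 ≤ p') (hq' : 0 ≤ q')
    (ha : 0 < a) (hb : 0 < b) :
    IntervalIntegrable
      (fun u => ∫ v in ridge p' q' u..ridge p q u, u ^ (a - 1) * v ^ (b - 1)) volume 0 1 := by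
  simp only [integral_between_ridges _ hb]
  exact ((intervalIntegrable_rpow_mul_ridge_rpow hp hq ha hb).sub
    (intervalIntegrable_rpow_mul_ridge_rpow hp' hq' ha hb)).const_mul _

theorem integral_sector (hp : 0 ≤ p) (hq : 0 ≤ q) (hpq : ¬(p = 0 ∧ q = 0)) (hp' : 0 ≤ p')
    (hq' : 0 ≤ q') (hpq' : ¬(p' = 0 ∧ q' = 0)) (ha : 0 < a) (hb : 0 < b) :
    ∫ u in (0 : ℝ)..1, ∫ v in ridge p' q' u..ridge p q u, u ^ (a - 1) * v ^ (b - 1)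
      = sectorMass a b p q p' q' := by
  have hpos := mul_add_mul_pos ha hb hp hq hpq
  have hpos' := mul_add_mul_pos ha hb hp' hq' hpq'
  simp only [integral_between_ridges _ hb]
  rw [intervalIntegral.integral_const_mul,
    intervalIntegral.integral_sub (intervalIntegrable_rpow_mul_ridge_rpow hp hq ha hb)
      (intervalIntegrable_rpow_mul_ridge_rpow hp' hq' ha hb),
    integral_rpow_mul_ridge_rpow hp hq ha hb, integral_rpow_mul_ridge_rpow hp' hq' ha hb,
    div_sub_div _ _ hpos.ne' hpos'.ne', sectorMass, mul_div_assoc']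
  congr 1
  field_simp
  ring

theorem sectorMass_two_mul (a b p q p' q' : ℝ) :
    sectorMass (2 * a) (2 * b) p q p' q' = sectorMass a b p q p' q' / 4 := by
  have hden (x y : ℝ) : 2 * b * x + 2 * a * y = 2 * (b * x + a * y) := by ring
  rw [sectorMass, sectorMass, hden, hden, mul_mul_mul_comm, div_div]
  ring_nf

theorem sectorMass_of_ne_zero (a b p p' : ℝ) (hq : q ≠ 0) (hq' : q' ≠ 0) :
    sectorMass a b p q p' q'
      = (p' / q' - p / q) / ((b * (p / q) + a) * (b * (p' / q') + a)) := by
  have hnum : p' / q' - p / q = (p' * q - p * q') / (q * q') := by field_simp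
  have hden : (b * (p / q) + a) * (b * (p' / q') + a)
      = (b * p + a * q) * (b * p' + a * q') / (q * q') := by field_simp
  rw [hnum, hden, div_div_div_cancel_right₀ (mul_ne_zero hq hq'), sectorMass]

theorem sectorMass_axes_add (h : 2 * q + p ≠ 0) (h' : q' + 2 * p' ≠ 0) :
    sectorMass 2 1 0 1 p q + sectorMass 1 2 p' q' 1 0 = cornerMass p q p' q' := by
  have hden : (1 * 0 + 2 * 1) * (1 * p + 2 * q) = 2 * (2 * q + p) := by ring
  have hden' : (2 * p' + 1 * q') * (2 * 1 + 1 * 0) = 2 * (q' + 2 * p') := by ring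
  rw [sectorMass, sectorMass, cornerMass, hden, hden',
    div_add_div _ _ (mul_ne_zero two_ne_zero h) (mul_ne_zero two_ne_zero h'),
    div_eq_div_iff (mul_ne_zero (mul_ne_zero two_ne_zero h) (mul_ne_zero two_ne_zero h'))
      (mul_ne_zero h h')]
  ring

theorem cornerMass_of_ne_zero (p p' : ℝ) (hq : q ≠ 0) (hq' : q' ≠ 0) :
    cornerMass p q p' q'
      = (1 + p / q + p / q * (p' / q')) / ((2 + p / q) * (1 + 2 * (p' / q'))) := by
  have hnum : 1 + p / q + p / q * (p' / q') = (q * q' + p * q' + p * p') / (q * q') := by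
    field_simp
  have hden : (2 + p / q) * (1 + 2 * (p' / q'))
      = (2 * q + p) * (q' + 2 * p') / (q * q') := by field_simp
  rw [hnum, hden, div_div_div_cancel_right₀ (mul_ne_zero hq hq'), cornerMass]

end Ridge

theorem intervalIntegral_eq_sum_of_antitone_steps {t : ℕ → ℝ} {n : ℕ} {f : ℝ → ℝ}
    {g : ℕ → ℝ → ℝ} (ht : ∀ k < n, t (k + 1) ≤ t k)
    (hfg : ∀ k < n, EqOn f (g k) (Ioo (t (k + 1)) (t k)))
    (hg : ∀ k < n, IntervalIntegrable (g k) volume (t (k + 1)) (t k)) :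
    ∫ v in t n..t 0, f v = ∑ k ∈ Finset.range n, ∫ v in t (k + 1)..t k, g k v := by
  have hf : ∀ k < n, IntervalIntegrable f volume (t k) (t (k + 1)) := fun k hk =>
    ((hg k hk).congr_uIoo (by rw [uIoo_of_le (ht k hk)]; exact (hfg k hk).symm)).symm
  rw [intervalIntegral.integral_symm, ← intervalIntegral.sum_integral_adjacent_intervals hf,
    ← Finset.sum_neg_distrib]
  refine Finset.sum_congr rfl fun k hk => ?_
  rw [Finset.mem_range] at hk
  rw [← intervalIntegral.integral_symm,
    intervalIntegral.integral_congr_Ioo_of_le (ht k hk) (hfg k hk)]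

/-- The pairs `(p k, q k)`, `1 ≤ k ≤ K`, are weights sorted by slope, completed by the slopes `0`
and `∞` of the sides of the unit square: `(p 0, q 0) = (0, 1)`, whose ridge is `v = 1`, and
`(p (K + 1), q (K + 1)) = (1, 0)`, whose ridge is `v = 0`. -/
structure IsSlopeOrdered (K : ℕ) (p q : ℕ → ℝ) : Prop where
  left_nonneg : ∀ k, 0 ≤ p k
  right_nonneg : ∀ k, 0 ≤ q k
  ne_zero : ∀ k, ¬(p k = 0 ∧ q k = 0)
  ratio_mono : Monotone (ratio p q)
  left_first : p 0 = 0
  right_first : q 0 = 1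
  left_last : p (K + 1) = 1
  right_last : q (K + 1) = 0
  sum_left : ∑ k ∈ Finset.Icc 1 K, p k = 1
  sum_right : ∑ k ∈ Finset.Icc 1 K, q k = 1

/-- The open part of the unit square between the ridges of numbers `k + 1` (below) and `k`
(above). -/
def sector (p q : ℕ → ℝ) (k : ℕ) : Set (ℝ × ℝ) :=
  {z | z.1 ∈ Ioo 0 1 ∧ z.2 ∈ Ioo (ridge (p (k + 1)) (q (k + 1)) z.1) (ridge (p k) (q k) z.1)}

theorem sector_subset (p q : ℕ → ℝ) (k : ℕ) : sector p q k ⊆ Ioo 0 1 ×ˢ Ioi 0 :=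
  fun _ hz => ⟨hz.1, (ridge_nonneg hz.1.1.le).trans_lt hz.2.1⟩

namespace IsSlopeOrdered

variable {K k j : ℕ} {p q : ℕ → ℝ} {u : ℝ} {z : ℝ × ℝ}

theorem partialSum_left_le_one (h : IsSlopeOrdered K p q) (hk : k ≤ K) : partialSum p k ≤ 1 :=
  h.sum_left ▸ Finset.sum_le_sum_of_subset_of_nonneg (Finset.Icc_subset_Icc_right hk)
    fun j _ _ => h.left_nonneg j

theorem partialSum_right_nonneg (h : IsSlopeOrdered K p q) : 0 ≤ partialSum q k :=
  Finset.sum_nonneg fun j _ => h.right_nonneg j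

theorem sum_left_Ioc (h : IsSlopeOrdered K p q) (hk : k ≤ K) :
    ∑ j ∈ Finset.Ioc k K, p j = 1 - partialSum p k := by
  rw [← h.sum_left, partialSum, eq_sub_iff_add_eq']
  exact Finset.sum_Ioc_consecutive p k.zero_le hk

theorem one_le (h : IsSlopeOrdered K p q) : 1 ≤ K := by
  by_contra hK
  simpa [Finset.Icc_eq_empty hK] using h.sum_left

theorem antitone_ridge (h : IsSlopeOrdered K p q) (hu : u ∈ Ioo (0 : ℝ) 1) :
    Antitone fun k => ridge (p k) (q k) u := fun i j hij =>
  ridge_le_ridge_of_ratio_le (h.left_nonneg i) (h.right_nonneg i) (h.ne_zero i) (h.left_nonneg j)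
    (h.right_nonneg j) (h.ratio_mono hij) hu

theorem rpow_lt_of_mem_sector (h : IsSlopeOrdered K p q) (hz : z ∈ sector p q k) (hj : j ≤ k) :
    z.2 ^ q j < z.1 ^ p j :=
  rpow_lt_of_lt_ridge (h.right_nonneg j) hz.1.1 (sector_subset p q k hz).2
    (hz.2.2.trans_le (h.antitone_ridge hz.1 hj))

theorem lt_rpow_of_mem_sector (h : IsSlopeOrdered K p q) (hz : z ∈ sector p q k) (hj : k < j) :
    z.1 ^ p j < z.2 ^ q j :=
  lt_rpow_of_ridge_lt (h.left_nonneg j) (h.right_nonneg j) (h.ne_zero j) hz.1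
    (sector_subset p q k hz).2 ((h.antitone_ridge hz.1 hj).trans_lt hz.2.1)

theorem filter_lt_rpow_eq_Ioc (h : IsSlopeOrdered K p q) (hz : z ∈ sector p q k) :
    {j ∈ Finset.Icc 1 K | z.1 ^ p j < z.2 ^ q j} = Finset.Ioc k K := by
  ext j
  have hiff : z.1 ^ p j < z.2 ^ q j ↔ k < j :=
    ⟨fun hlt => not_le.1 fun hj => (h.rpow_lt_of_mem_sector hz hj).not_gt hlt,
      h.lt_rpow_of_mem_sector hz⟩
  simp only [Finset.mem_filter, Finset.mem_Icc, Finset.mem_Ioc, hiff]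
  omega

theorem filter_rpow_lt_eq_Icc (h : IsSlopeOrdered K p q) (hk : k ≤ K) (hz : z ∈ sector p q k) :
    {j ∈ Finset.Icc 1 K | z.2 ^ q j < z.1 ^ p j} = Finset.Icc 1 k := by
  ext j
  have hiff : z.2 ^ q j < z.1 ^ p j ↔ j ≤ k :=
    ⟨fun hlt => not_lt.1 fun hj => (h.lt_rpow_of_mem_sector hz hj).not_gt hlt,
      h.rpow_lt_of_mem_sector hz⟩
  simp only [Finset.mem_filter, Finset.mem_Icc, hiff]
  omega

theorem liebscherCL_of_mem_sector (h : IsSlopeOrdered K p q) (hk : k ≤ K)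
    (hz : z ∈ sector p q k) :
    liebscherCL K p q z.1 z.2 = z.1 ^ (1 - partialSum p k) * z.2 ^ partialSum q k :=
  calc liebscherCL K p q z.1 z.2
      = (∏ j ∈ Finset.Icc 1 k, min (z.1 ^ p j) (z.2 ^ q j))
          * ∏ j ∈ Finset.Ioc k K, min (z.1 ^ p j) (z.2 ^ q j) :=
        (Finset.prod_Ioc_consecutive _ k.zero_le hk).symm
    _ = (∏ j ∈ Finset.Icc 1 k, z.2 ^ q j) * ∏ j ∈ Finset.Ioc k K, z.1 ^ p j := by
        congr 1
        · exact Finset.prod_congr rfl fun j hj =>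
            min_eq_right (h.rpow_lt_of_mem_sector hz (Finset.mem_Icc.1 hj).2).le
        · exact Finset.prod_congr rfl fun j hj =>
            min_eq_left (h.lt_rpow_of_mem_sector hz (Finset.mem_Ioc.1 hj).1).le
    _ = z.1 ^ (1 - partialSum p k) * z.2 ^ partialSum q k := by
        rw [← Real.rpow_sum_of_pos (sector_subset p q k hz).2, ← Real.rpow_sum_of_pos hz.1.1,
          h.sum_left_Ioc hk, ← partialSum, mul_comm]

theorem liebscherDeriv_mul_liebscherDeriv_of_mem_sector (h : IsSlopeOrdered K p q) (hk : k ≤ K)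
    (hz : z ∈ sector p q k) :
    liebscherDeriv K p q z.1 z.2 * liebscherDeriv K q p z.2 z.1
      = (1 - partialSum p k) * partialSum q k *
        (z.1 ^ (2 * (1 - partialSum p k) - 1) * z.2 ^ (2 * partialSum q k - 1)) := by
  have hu : 0 < z.1 := hz.1.1
  have hv : 0 < z.2 := (sector_subset p q k hz).2
  rw [liebscherDeriv, liebscherDeriv, liebscherCL_swap K q p, h.liebscherCL_of_mem_sector hk hz,
    h.filter_lt_rpow_eq_Ioc hz, h.filter_rpow_lt_eq_Icc hk hz, h.sum_left_Ioc hk, ← partialSum,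
    Real.rpow_sub_one hu.ne', Real.rpow_sub_one hv.ne', two_mul, two_mul, Real.rpow_add hu,
    Real.rpow_add hv]
  ring

theorem integral_eq_sum_ridges (h : IsSlopeOrdered K p q) (hu : u ∈ Ioo (0 : ℝ) 1) {f : ℝ → ℝ}
    {g : ℕ → ℝ → ℝ}
    (hfg : ∀ k ≤ K, EqOn f (g k) (Ioo (ridge (p (k + 1)) (q (k + 1)) u) (ridge (p k) (q k) u)))
    (hg : ∀ k ≤ K, IntervalIntegrable (g k) volume (ridge (p (k + 1)) (q (k + 1)) u)
      (ridge (p k) (q k) u)) :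
    ∫ v in (0 : ℝ)..1, f v = ∑ k ∈ Finset.range (K + 1),
      ∫ v in ridge (p (k + 1)) (q (k + 1)) u..ridge (p k) (q k) u, g k v := by
  have hfirst : ridge (p 0) (q 0) u = 1 := by
    rw [h.left_first, h.right_first, ridge_zero_left one_ne_zero]
  have hlast : ridge (p (K + 1)) (q (K + 1)) u = 0 := by rw [h.right_last, ridge_zero_right]
  rw [← intervalIntegral_eq_sum_of_antitone_steps (t := fun k => ridge (p k) (q k) u)
    (fun k _ => h.antitone_ridge hu k.le_succ) (fun k hk => hfg k (Nat.le_of_lt_succ hk))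
    (fun k hk => hg k (Nat.le_of_lt_succ hk)), hfirst, hlast]

theorem integral_integral_eq_sum_sectorMass (h : IsSlopeOrdered K p q) {f : ℝ → ℝ → ℝ}
    {a b c : ℕ → ℝ}
    (hf : ∀ k ≤ K, ∀ z ∈ sector p q k, f z.1 z.2 = c k * (z.1 ^ (a k - 1) * z.2 ^ (b k - 1)))
    (hc : ∀ k ≤ K, c k ≠ 0 → 0 < a k ∧ 0 < b k) :
    ∫ u in (0 : ℝ)..1, ∫ v in (0 : ℝ)..1, f u v
      = ∑ k ∈ Finset.range (K + 1),
          c k * sectorMass (a k) (b k) (p k) (q k) (p (k + 1)) (q (k + 1)) := by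
  have hinner : EqOn (fun u => ∫ v in (0 : ℝ)..1, f u v)
      (fun u => ∑ k ∈ Finset.range (K + 1), c k *
        ∫ v in ridge (p (k + 1)) (q (k + 1)) u..ridge (p k) (q k) u,
          u ^ (a k - 1) * v ^ (b k - 1)) (Ioo 0 1) := by
    intro u hu
    simp only [← intervalIntegral.integral_const_mul]
    refine h.integral_eq_sum_ridges hu (fun k hk v hv => hf k hk (u, v) ⟨hu, hv⟩) fun k hk => ?_
    by_cases hck : c k = 0
    · simp [hck]
    · have hb := (hc k hk hck).2
      exact ((intervalIntegral.intervalIntegrable_rpow' (by linarith)).const_mul _).const_mul _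
  rw [intervalIntegral.integral_congr_Ioo_of_le zero_le_one hinner,
    intervalIntegral.integral_finsetSum]
  · refine Finset.sum_congr rfl fun k hk => ?_
    rw [intervalIntegral.integral_const_mul]
    by_cases hck : c k = 0
    · simp [hck]
    · obtain ⟨ha, hb⟩ := hc k (Finset.mem_range_succ_iff.1 hk) hck
      rw [integral_sector (h.left_nonneg _) (h.right_nonneg _) (h.ne_zero _) (h.left_nonneg _)
        (h.right_nonneg _) (h.ne_zero _) ha hb]
  · intro k hk
    by_cases hck : c k = 0
    · simp [hck]
    · obtain ⟨ha, hb⟩ := hc k (Finset.mem_range_succ_iff.1 hk) hck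
      exact (intervalIntegrable_sector (h.left_nonneg _) (h.right_nonneg _) (h.left_nonneg _)
        (h.right_nonneg _) ha hb).const_mul _

theorem kendallTau_liebscherCL (h : IsSlopeOrdered K p q) :
    kendallTau (liebscherCL K p q) = 1 - ∑ k ∈ Finset.Ico 1 K,
      (1 - partialSum p k) * partialSum q k * sectorMass (1 - partialSum p k) (partialSum q k)
        (p k) (q k) (p (k + 1)) (q (k + 1)) := by
  have hfirst : partialSum q 0 = 0 := by simp [partialSum]
  have hlast : partialSum p K = 1 := h.sum_left
  have hpos (k : ℕ) (hk : k ≤ K) (hc : (1 - partialSum p k) * partialSum q k ≠ 0) :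
      0 < 2 * (1 - partialSum p k) ∧ 0 < 2 * partialSum q k := by
    have ha := sub_nonneg.2 (h.partialSum_left_le_one hk)
    exact ⟨mul_pos two_pos (ha.lt_of_ne' (left_ne_zero_of_mul hc)),
      mul_pos two_pos (h.partialSum_right_nonneg.lt_of_ne' (right_ne_zero_of_mul hc))⟩
  rw [kendallTau_liebscherCL_eq_integral (fun k _ => h.left_nonneg k)
    (fun k _ => h.right_nonneg k) h.sum_left h.sum_right,
    h.integral_integral_eq_sum_sectorMass
      (fun k hk z hz => h.liebscherDeriv_mul_liebscherDeriv_of_mem_sector hk hz) hpos,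
    Finset.sum_range_succ, Finset.range_eq_Ico, Finset.sum_eq_sum_Ico_succ_bot h.one_le, hfirst,
    hlast]
  simp only [sectorMass_two_mul, mul_zero, zero_mul, sub_self, zero_add, add_zero, mul_div_assoc',
    ← Finset.sum_div]
  rw [mul_div_cancel_left₀ _ four_ne_zero]

theorem spearmanRho_liebscherCL (h : IsSlopeOrdered K p q) :
    spearmanRho (liebscherCL K p q)
      = 12 * cornerMass (p 1) (q 1) (p K) (q K) - 3
        + 12 * ∑ k ∈ Finset.Ico 1 K, sectorMass (2 - partialSum p k) (1 + partialSum q k)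
          (p k) (q k) (p (k + 1)) (q (k + 1)) := by
  have hfirst (x : ℕ → ℝ) : partialSum x 0 = 0 := by simp [partialSum]
  have hlast_left : partialSum p K = 1 := h.sum_left
  have hlast_right : partialSum q K = 1 := h.sum_right
  have hsector (k : ℕ) (hk : k ≤ K) (z : ℝ × ℝ) (hz : z ∈ sector p q k) :
      liebscherCL K p q z.1 z.2
        = 1 * (z.1 ^ (2 - partialSum p k - 1) * z.2 ^ (1 + partialSum q k - 1)) := by
    rw [h.liebscherCL_of_mem_sector hk hz]
    ring_nf
  have hpos (k : ℕ) (hk : k ≤ K) : 0 < 2 - partialSum p k ∧ 0 < 1 + partialSum q k :=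
    ⟨by linarith [h.partialSum_left_le_one hk], add_pos_of_pos_of_nonneg one_pos
      h.partialSum_right_nonneg⟩
  have hden_first := mul_add_mul_pos two_pos one_pos (h.left_nonneg 1) (h.right_nonneg 1)
    (h.ne_zero 1)
  have hden_last := mul_add_mul_pos one_pos two_pos (h.left_nonneg K) (h.right_nonneg K)
    (h.ne_zero K)
  rw [spearmanRho_liebscherCL_eq_integral (fun k _ => h.left_nonneg k) h.sum_left,
    h.integral_integral_eq_sum_sectorMass hsector fun k hk _ => hpos k hk,
    Finset.sum_range_succ, Finset.range_eq_Ico, Finset.sum_eq_sum_Ico_succ_bot h.one_le,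
    ← sectorMass_axes_add (by linarith) (by linarith)]
  simp only [hfirst, hlast_left, hlast_right, h.left_first, h.right_first, h.left_last,
    h.right_last]
  ring_nf

end IsSlopeOrdered

/-- The sequence with the values of `x` at `1, …, K`, the value `a` at `0` and the value `b` beyond
`K`. It completes weights given on `1, …, K` to an `IsSlopeOrdered` pair. -/
noncomputable def padSeq (K : ℕ) (a b : ℝ) (x : ℕ → ℝ) (k : ℕ) : ℝ :=
  if k = 0 then a else if k ≤ K then x k else b

section padSeq

variable {K k : ℕ} {a b : ℝ} {x p q : ℕ → ℝ}

theorem padSeq_zero : padSeq K a b x 0 = a := if_pos rfl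

theorem padSeq_of_mem (hk : k ∈ Finset.Icc 1 K) : padSeq K a b x k = x k := by
  rw [Finset.mem_Icc] at hk
  rw [padSeq, if_neg (by lia), if_pos hk.2]

theorem padSeq_of_lt (hk : K < k) : padSeq K a b x k = b := by
  rw [padSeq, if_neg (by lia), if_neg hk.not_ge]

theorem eq_zero_or_mem_Icc_or_lt (K k : ℕ) : k = 0 ∨ k ∈ Finset.Icc 1 K ∨ K < k := by
  rw [Finset.mem_Icc]
  lia

theorem padSeq_nonneg (ha : 0 ≤ a) (hb : 0 ≤ b) (hx : ∀ k ∈ Finset.Icc 1 K, 0 ≤ x k) (k : ℕ) :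
    0 ≤ padSeq K a b x k := by
  rcases eq_zero_or_mem_Icc_or_lt K k with rfl | hk | hk
  · rwa [padSeq_zero]
  · rw [padSeq_of_mem hk]
    exact hx k hk
  · rwa [padSeq_of_lt hk]

theorem partialSum_padSeq (hk : k ≤ K) : partialSum (padSeq K a b x) k = partialSum x k :=
  Finset.sum_congr rfl fun _ hj => padSeq_of_mem (Finset.Icc_subset_Icc_right hk hj)

theorem liebscherCL_padSeq (a b c d : ℝ) :
    liebscherCL K (padSeq K a b p) (padSeq K c d q) = liebscherCL K p q := by
  ext u v
  exact Finset.prod_congr rfl fun k hk => by rw [padSeq_of_mem hk, padSeq_of_mem hk]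

theorem ratio_padSeq_of_mem (hk : k ∈ Finset.Icc 1 K) :
    ratio (padSeq K 0 1 p) (padSeq K 1 0 q) k = ratio p q k := by
  rw [ratio, padSeq_of_mem hk, padSeq_of_mem hk, ratio]

theorem monotone_ratio_padSeq (hr : MonotoneOn (ratio p q) (Icc 1 K)) :
    Monotone (ratio (padSeq K 0 1 p) (padSeq K 1 0 q)) := by
  intro i j hij
  rcases eq_zero_or_mem_Icc_or_lt K i with rfl | hi | hi
  · simp [ratio, padSeq_zero]
  · rcases le_or_gt j K with hj | hj
    · have hj_mem := Finset.mem_Icc.2 ⟨(Finset.mem_Icc.1 hi).1.trans hij, hj⟩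
      rw [ratio_padSeq_of_mem hi, ratio_padSeq_of_mem hj_mem]
      exact hr (Finset.mem_Icc.1 hi) (Finset.mem_Icc.1 hj_mem) hij
    · simp [ratio, padSeq_of_lt hj]
  · simp [ratio, padSeq_of_lt (hi.trans_le hij)]

theorem isSlopeOrdered_padSeq (hp : ∀ k ∈ Finset.Icc 1 K, 0 ≤ p k)
    (hq : ∀ k ∈ Finset.Icc 1 K, 0 ≤ q k) (hp1 : ∑ k ∈ Finset.Icc 1 K, p k = 1)
    (hq1 : ∑ k ∈ Finset.Icc 1 K, q k = 1)
    (hpq : ∀ k ∈ Finset.Icc 1 K, ¬(p k = 0 ∧ q k = 0))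
    (hr : MonotoneOn (ratio p q) (Icc 1 K)) :
    IsSlopeOrdered K (padSeq K 0 1 p) (padSeq K 1 0 q) where
  left_nonneg := padSeq_nonneg le_rfl zero_le_one hp
  right_nonneg := padSeq_nonneg zero_le_one le_rfl hq
  ne_zero k := by
    rcases eq_zero_or_mem_Icc_or_lt K k with rfl | hk | hk
    · simp [padSeq_zero]
    · rw [padSeq_of_mem hk, padSeq_of_mem hk]
      exact hpq k hk
    · simp [padSeq_of_lt hk]
  ratio_mono := monotone_ratio_padSeq hr
  left_first := padSeq_zero
  right_first := padSeq_zero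
  left_last := padSeq_of_lt K.lt_succ_self
  right_last := padSeq_of_lt K.lt_succ_self
  sum_left := (partialSum_padSeq le_rfl).trans hp1
  sum_right := (partialSum_padSeq le_rfl).trans hq1

end padSeq

section Formulas

variable {K : ℕ} {p q : ℕ → ℝ}

theorem kendallTau_liebscherCL (hp : ∀ k ∈ Finset.Icc 1 K, 0 ≤ p k)
    (hq : ∀ k ∈ Finset.Icc 1 K, 0 ≤ q k) (hp1 : ∑ k ∈ Finset.Icc 1 K, p k = 1)
    (hq1 : ∑ k ∈ Finset.Icc 1 K, q k = 1)
    (hpq : ∀ k ∈ Finset.Icc 1 K, ¬(p k = 0 ∧ q k = 0))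
    (hr : MonotoneOn (ratio p q) (Icc 1 K)) :
    kendallTau (liebscherCL K p q) = 1 - ∑ k ∈ Finset.Ico 1 K,
      (1 - partialSum p k) * partialSum q k * sectorMass (1 - partialSum p k) (partialSum q k)
        (p k) (q k) (p (k + 1)) (q (k + 1)) := by
  rw [← liebscherCL_padSeq 0 1 1 0,
    (isSlopeOrdered_padSeq hp hq hp1 hq1 hpq hr).kendallTau_liebscherCL]
  refine congrArg (1 - ·) (Finset.sum_congr rfl fun k hk => ?_)
  obtain ⟨h1k, hkK⟩ := Finset.mem_Ico.1 hk
  have hmem : k ∈ Finset.Icc 1 K := Finset.mem_Icc.2 ⟨h1k, hkK.le⟩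
  have hmem_succ : k + 1 ∈ Finset.Icc 1 K := Finset.mem_Icc.2 ⟨k.succ_pos, hkK⟩
  simp only [padSeq_of_mem hmem, padSeq_of_mem hmem_succ, partialSum_padSeq hkK.le]

theorem spearmanRho_liebscherCL (hp : ∀ k ∈ Finset.Icc 1 K, 0 ≤ p k)
    (hq : ∀ k ∈ Finset.Icc 1 K, 0 ≤ q k) (hp1 : ∑ k ∈ Finset.Icc 1 K, p k = 1)
    (hq1 : ∑ k ∈ Finset.Icc 1 K, q k = 1)
    (hpq : ∀ k ∈ Finset.Icc 1 K, ¬(p k = 0 ∧ q k = 0))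
    (hr : MonotoneOn (ratio p q) (Icc 1 K)) :
    spearmanRho (liebscherCL K p q)
      = 12 * cornerMass (p 1) (q 1) (p K) (q K) - 3
        + 12 * ∑ k ∈ Finset.Ico 1 K, sectorMass (2 - partialSum p k) (1 + partialSum q k)
          (p k) (q k) (p (k + 1)) (q (k + 1)) := by
  have h := isSlopeOrdered_padSeq hp hq hp1 hq1 hpq hr
  have hfirst : 1 ∈ Finset.Icc 1 K := Finset.left_mem_Icc.2 h.one_le
  have hlast : K ∈ Finset.Icc 1 K := Finset.right_mem_Icc.2 h.one_le
  rw [← liebscherCL_padSeq 0 1 1 0, h.spearmanRho_liebscherCL]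
  simp only [padSeq_of_mem hfirst, padSeq_of_mem hlast]
  refine congrArg (_ + 12 * ·) (Finset.sum_congr rfl fun k hk => ?_)
  obtain ⟨h1k, hkK⟩ := Finset.mem_Ico.1 hk
  have hmem : k ∈ Finset.Icc 1 K := Finset.mem_Icc.2 ⟨h1k, hkK.le⟩
  have hmem_succ : k + 1 ∈ Finset.Icc 1 K := Finset.mem_Icc.2 ⟨k.succ_pos, hkK⟩
  simp only [padSeq_of_mem hmem, padSeq_of_mem hmem_succ, partialSum_padSeq hkK.le]

end Formulas

theorem proposition8 (K : ℕ) (p q : ℕ → ℝ)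
    (hp : ∀ k ∈ Finset.Icc 1 K, 0 ≤ p k) (hq : ∀ k ∈ Finset.Icc 1 K, 0 ≤ q k)
    (hp1 : ∑ k ∈ Finset.Icc 1 K, p k = 1) (hq1 : ∑ k ∈ Finset.Icc 1 K, q k = 1) :
    IsCopula (liebscherCL K p q) ∧
    blomqvistBeta (liebscherCL K p q)
      = (2 : ℝ) ^ (∑ k ∈ Finset.Icc 1 K, min (p k) (q k)) - 1 ∧
    ((∀ k ∈ Finset.Icc 1 K, ¬ (p k = 0 ∧ q k = 0)) →
      MonotoneOn (ratio p q) (Set.Icc 1 K) →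
      -- the formulas for all ratios `r_k` in `[0,∞]`: numerators and denominators are multiplied
      -- by `q_k q_{k+1}` (by `q_1 q_K` in the first term of `ρ`)
      kendallTau (liebscherCL K p q)
        = 1 - ∑ k ∈ Finset.Ico 1 K,
            (1 - partialSum p k) * partialSum q k * (p (k + 1) * q k - p k * q (k + 1)) /
              ((partialSum q k * p k + (1 - partialSum p k) * q k) *
                (partialSum q k * p (k + 1) + (1 - partialSum p k) * q (k + 1))) ∧
      spearmanRho (liebscherCL K p q)
        = 12 * (q 1 * q K + p 1 * q K + p 1 * p K) / ((2 * q 1 + p 1) * (q K + 2 * p K)) - 3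
          + 12 * ∑ k ∈ Finset.Ico 1 K,
            (p (k + 1) * q k - p k * q (k + 1)) /
              (((1 + partialSum q k) * p k + (2 - partialSum p k) * q k) *
                ((1 + partialSum q k) * p (k + 1) + (2 - partialSum p k) * q (k + 1))) ∧
      -- the formulas in terms of `r_k = p_k / q_k` when all ratios are finite
      ((∀ k ∈ Finset.Icc 1 K, 0 < q k) → ∀ r : ℕ → ℝ, (∀ k, r k = p k / q k) →
        kendallTau (liebscherCL K p q)
          = 1 - ∑ k ∈ Finset.Ico 1 K,
              (1 - partialSum p k) * partialSum q k * (r (k + 1) - r k) /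
                ((partialSum q k * r k + (1 - partialSum p k)) *
                  (partialSum q k * r (k + 1) + (1 - partialSum p k))) ∧
        spearmanRho (liebscherCL K p q)
          = 12 * (1 + r 1 + r 1 * r K) / ((2 + r 1) * (1 + 2 * r K)) - 3
            + 12 * ∑ k ∈ Finset.Ico 1 K,
              (r (k + 1) - r k) /
                (((1 + partialSum q k) * r k + (2 - partialSum p k)) *
                  ((1 + partialSum q k) * r (k + 1) + (2 - partialSum p k))))) := by
  refine ⟨isCopula_liebscherCL hp hq hp1 hq1, blomqvistBeta_liebscherCL hp1 hq1,
    fun hpq hr => ?_⟩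
  have tau := kendallTau_liebscherCL hp hq hp1 hq1 hpq hr
  have rho := spearmanRho_liebscherCL hp hq hp1 hq1 hpq hr
  refine ⟨by simpa only [sectorMass, mul_div_assoc] using tau,
    by simpa only [sectorMass, cornerMass, mul_div_assoc] using rho, fun hq0 r hr_eq => ?_⟩
  have hK : 1 ≤ K := (isSlopeOrdered_padSeq hp hq hp1 hq1 hpq hr).one_le
  have hq_ne (k : ℕ) (h1 : 1 ≤ k) (hk : k ≤ K) : q k ≠ 0 := (hq0 k (Finset.mem_Icc.2 ⟨h1, hk⟩)).ne'
  have hsector (a b : ℝ) {k : ℕ} (hk : k ∈ Finset.Ico 1 K) :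
      sectorMass a b (p k) (q k) (p (k + 1)) (q (k + 1))
        = (r (k + 1) - r k) / ((b * r k + a) * (b * r (k + 1) + a)) := by
    obtain ⟨h1k, hkK⟩ := Finset.mem_Ico.1 hk
    rw [hr_eq, hr_eq, sectorMass_of_ne_zero _ _ _ _ (hq_ne k h1k hkK.le)
      (hq_ne (k + 1) k.succ_pos hkK)]
  have hcorner : cornerMass (p 1) (q 1) (p K) (q K)
      = (1 + r 1 + r 1 * r K) / ((2 + r 1) * (1 + 2 * r K)) := by
    rw [hr_eq, hr_eq, cornerMass_of_ne_zero _ _ (hq_ne 1 le_rfl hK) (hq_ne K hK le_rfl)]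
  constructor
  · rw [tau, Finset.sum_congr rfl fun k hk => by rw [hsector _ _ hk, ← mul_div_assoc]]
  · rw [rho, hcorner, Finset.sum_congr rfl fun k hk => hsector _ _ hk, ← mul_div_assoc]
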